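/- Let $f(z)=\sum_{k\ge 0}a_kz^k$ be a power series with integer coefficients, infinitely many of them non-zero, and with positive radius of convergence $R_f$. Assume that $f$ is strongly lacunary, that is, there are integer sequences $(s_n)_{n\ge 1}$ and $(t_n)_{n\ge 0}$ such that $$0\le t_0\le s_1<t_1\le s_2<t_2\le s_3<\cdots,$$ $a_k=0$ for $k<t_0$ and for $s_n<k<t_n$ ($n=1,2,\ldots$), and $t_n/s_n\to\infty$ as $n\to\infty$. Fix such sequences and, for $n\ge 1$, put $P_n(z)=\sum_{k=t_{n-1}}^{s_n}a_kz^k$. Assume moreover that $f$ is of bounded type, that is, there exists $A>0$ such that $|a_k|\le A$ for all $k$ (so that $R_f=1$). Let $d$ be a positive real number. Then for all but finitely many complex algebraic numbers $\alpha$ of degree (over $\mathbb{Q}$) at most $d$, Mahler's condition $$P_n(\alpha)\ne 0\quad\text{for infinitely many } n$$ holds. Moreover, for every algebraic $\alpha$ of degree at most $d$ with $|\alpha|<R_f$ that satisfies this condition, the series $f(\alpha)=\sum_{k\ge0}a_k\alpha^k$ converges absolutely and its sum is transcendental. In particular, $f(\alpha)$ is transcendental for all but finitely many algebraic numbers $\alpha$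 of degree at most $d$ with $|\alpha|<R_f$. -/

import Mathlib

open scoped ENNReal NNReal PowerSeries

noncomputable section

namespace LacunarySeries

/-- The radius of convergence `R_f` of an integer power series over `ℂ`. -/
def radius (f : ℤ⟦X⟧) : ℝ≥0∞ :=
  (FormalMultilinearSeries.ofScalars ℂ (fun k : ℕ => ((PowerSeries.coeff k f : ℤ) : ℂ))).radius

/-- `f` is a strongly lacunary power series, as witnessed by the sequences `(s_n)_{n ≥ 1}` and
`(t_n)_{n ≥ 0}`. (The value `s 0` plays no role.) The first two fields are the general conventions
on power series: the radius of convergence is positive and `f` is not a polynomial. -/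
structure StronglyLacunaryWith (f : ℤ⟦X⟧) (s t : ℕ → ℕ) : Prop where
  radius_pos : 0 < radius f
  infinite_support : {k : ℕ | PowerSeries.coeff k f ≠ 0}.Infinite
  t_le_s : ∀ n, t n ≤ s (n + 1)
  s_lt_t : ∀ n, 1 ≤ n → s n < t n
  coeff_eq_zero_of_lt : ∀ k, k < t 0 → PowerSeries.coeff k f = 0
  coeff_eq_zero_of_gap : ∀ n, 1 ≤ n → ∀ k, s n < k → k < t n → PowerSeries.coeff k f = 0
  tendsto_ratio :
    Filter.Tendsto (fun n : ℕ => (t n : ℝ) / (s n : ℝ)) Filter.atTop Filter.atTop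

/-- `f` is of bounded type: its coefficients are bounded. -/
def BoundedType (f : ℤ⟦X⟧) : Prop :=
  ∃ A : ℝ, 0 < A ∧ ∀ k : ℕ, |((PowerSeries.coeff k f : ℤ) : ℝ)| ≤ A

/-- The block `P_n(z) = ∑_{k = t_{n-1}}^{s_n} a_k z^k`, for `n ≥ 1`. -/
def block (f : ℤ⟦X⟧) (s t : ℕ → ℕ) (n : ℕ) : Polynomial ℤ :=
  ∑ k ∈ Finset.Icc (t (n - 1)) (s n), Polynomial.monomial k (PowerSeries.coeff k f)

/-- Mahler's condition: `P_n(α) ≠ 0` for infinitely many `n ≥ 1`. -/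
def MahlerCondition (f : ℤ⟦X⟧) (s t : ℕ → ℕ) (α : ℂ) : Prop :=
  {n : ℕ | 1 ≤ n ∧ Polynomial.aeval α (block f s t n) ≠ 0}.Infinite

/-- The terms `a_k α^k` of the series `f(α)`. -/
def term (f : ℤ⟦X⟧) (α : ℂ) (k : ℕ) : ℂ :=
  ((PowerSeries.coeff k f : ℤ) : ℂ) * α ^ k

end LacunarySeries

end

section

open Polynomial

/-! Exceptional points: since `f` is not a polynomial, infinitely many blocks are nonzero, so if
Mahler's condition fails, `α` is a root of a nonzero integer polynomial with coefficients bounded by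
`A`. Its factor of degree `deg α` has Mahler measure at most `A * (A + 1) ^ d`, and Northcott's
theorem leaves finitely many such factors. Transcendence: suppose `β = f(α)` is algebraic. The
partial sum up to `s n` has error `O(q ^ t n)` with `q < 1`, as the gap contributes nothing, while
Liouville's inequality bounds a nonzero error below by `C ^ (-(s n + 1))`. As `t n / s n → ∞`, the
partial sums eventually equal `β`; their differences, the blocks at `α`, then vanish, against
Mahler's condition. -/

/-- By Gauss's lemma, an irreducible factor of positive degree in `ℤ[X]` stays irreducible over `ℚ`.
-/
theorem exists_dvd_natDegree_eq_minpoly {P : ℤ[X]} (hP : P ≠ 0) {α : ℂ} (h : aeval α P = 0) :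
    ∃ p : ℤ[X], p ∣ P ∧ aeval α p = 0 ∧ p.natDegree = (minpoly ℚ α).natDegree := by
  classical
  obtain ⟨u, hu⟩ := UniqueFactorizationMonoid.factors_prod hP
  have h0 : aeval α (UniqueFactorizationMonoid.factors P).prod = 0 := by
    rw [← hu, map_mul] at h
    exact (mul_eq_zero.mp h).resolve_right ((u.isUnit.map (aeval α)).ne_zero)
  rw [map_multiset_prod, Multiset.prod_eq_zero_iff, Multiset.mem_map] at h0
  obtain ⟨p, hp, hpα⟩ := h0
  have hirr := UniqueFactorizationMonoid.irreducible_of_factor p hp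
  have hdeg : p.natDegree ≠ 0 := by
    intro h0
    rw [natDegree_eq_zero] at h0
    obtain ⟨c, rfl⟩ := h0
    rw [aeval_C, algebraMap_int_eq, eq_intCast, Int.cast_eq_zero] at hpα
    exact hirr.ne_zero (by rw [hpα, C_0])
  refine ⟨p, UniqueFactorizationMonoid.dvd_of_mem_factors hp, hpα, ?_⟩
  have hprim := hirr.isPrimitive hdeg
  have hirrQ := (IsPrimitive.Int.irreducible_iff_irreducible_map_cast hprim).mp hirr
  have hroot : aeval α (p.map (Int.castRingHom ℚ)) = 0 := by
    rw [← algebraMap_int_eq, aeval_map_algebraMap]; exact hpα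
  rw [← minpoly.eq_of_irreducible hirrQ hroot, natDegree_mul_C
    (inv_ne_zero (leadingCoeff_ne_zero.mpr hirrQ.ne_zero)),
    natDegree_map_eq_of_injective (Int.castRingHom ℚ).injective_int]

/-- Cauchy's root bound; the leading coefficient, a nonzero integer, has absolute value at least 1.
-/
theorem norm_le_of_aeval_eq_zero {P : ℤ[X]} (hP : P ≠ 0) {A : ℝ}
    (hA : ∀ i, |(P.coeff i : ℝ)| ≤ A) {z : ℂ} (h : aeval z P = 0) : ‖z‖ ≤ A + 1 := by
  have hinj := (Int.castRingHom ℂ).injective_int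
  have hA0 : 0 ≤ A := (abs_nonneg _).trans (hA 0)
  have hne : P.map (Int.castRingHom ℂ) ≠ 0 := (Polynomial.map_ne_zero_iff hinj).mpr hP
  have hr : (P.map (Int.castRingHom ℂ)).IsRoot z := by
    rw [IsRoot.def, eval_map, ← algebraMap_int_eq, ← aeval_def]; exact h
  have hlt := hr.norm_lt_cauchyBound hne
  have hle : cauchyBound (P.map (Int.castRingHom ℂ)) ≤ A.toNNReal + 1 := by
    unfold cauchyBound
    gcongr
    refine (div_le_self zero_le ?_).trans (Finset.sup_le fun i _ => ?_)
    · rw [leadingCoeff_map_of_injective hinj, ← NNReal.coe_le_coe]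
      have : 1 ≤ |P.leadingCoeff| := Int.one_le_abs (leadingCoeff_ne_zero.mpr hP)
      simpa [Int.norm_eq_abs] using (by exact_mod_cast this : (1 : ℝ) ≤ |(P.leadingCoeff : ℝ)|)
    · rw [← NNReal.coe_le_coe, Real.coe_toNNReal _ hA0]
      simpa [Int.norm_eq_abs] using hA i
  have := NNReal.coe_le_coe.mpr (hlt.le.trans hle)
  simpa [hA0] using this

theorem finite_roots_of_natDegree_minpoly_le (A : ℝ) (d : ℕ) :
    {α : ℂ | (minpoly ℚ α).natDegree ≤ d ∧
      ∃ P : ℤ[X], P ≠ 0 ∧ (∀ i, |(P.coeff i : ℝ)| ≤ A) ∧ aeval α P = 0}.Finite := by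
  classical
  have hinj := (Int.castRingHom ℂ).injective_int
  have hfin := finite_mahlerMeasure_le d (A * (A + 1) ^ d).toNNReal
  refine (hfin.biUnion fun p _ => (p.map (Int.castRingHom ℂ)).roots.toFinset.finite_toSet).subset ?_
  rintro α ⟨hd, P, hP, hA, hα⟩
  obtain ⟨p, hpP, hpα, hdeg⟩ := exists_dvd_natDegree_eq_minpoly hP hα
  have hA0 : 0 ≤ A := (abs_nonneg _).trans (hA 0)
  have hp : p ≠ 0 := ne_zero_of_dvd_ne_zero hP hpP
  have hpC : p.map (Int.castRingHom ℂ) ≠ 0 := (Polynomial.map_ne_zero_iff hinj).mpr hp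
  simp only [Set.mem_iUnion]
  refine ⟨p, ⟨hdeg.trans_le hd, ?_⟩, ?_⟩
  -- The leading coefficient of `p` divides that of `P`, and the roots of `p` are roots of `P`.
  · rw [Real.coe_toNNReal _ (by positivity), mahlerMeasure_eq_leadingCoeff_mul_prod_roots]
    refine mul_le_mul ?_ ?_ (zero_le_one.trans (one_le_prod_max_one_norm_roots _)) hA0
    · rw [leadingCoeff_map_of_injective hinj, eq_intCast, Complex.norm_intCast]
      refine le_trans ?_ (hA P.natDegree)
      have h1 := Int.le_of_dvd (abs_pos.mpr (leadingCoeff_ne_zero.mpr hP))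
        ((abs_dvd_abs _ _).mpr (leadingCoeff_dvd_leadingCoeff hpP))
      exact_mod_cast h1
    · have hz : ∀ z ∈ (p.map (Int.castRingHom ℂ)).roots, max 1 ‖z‖ ≤ A + 1 := by
        intro z hz
        refine max_le (by linarith) (norm_le_of_aeval_eq_zero hP hA ?_)
        rw [mem_roots hpC, IsRoot.def, eval_map, ← algebraMap_int_eq, ← aeval_def] at hz
        exact aeval_eq_zero_of_dvd_aeval_eq_zero hpP hz
      refine (Multiset.prod_map_le_prod_map₀ _ (fun _ => A + 1)
        (fun z _ => zero_le_one.trans (le_max_left _ _)) hz).trans ?_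
      rw [Multiset.map_const', Multiset.prod_replicate]
      exact pow_le_pow_right₀ (by linarith)
        ((card_roots' _).trans (natDegree_map_le.trans (hdeg.trans_le hd)))
  · simp only [Finset.mem_coe, Multiset.mem_toFinset, mem_roots hpC, IsRoot.def, eval_map]
    rw [← algebraMap_int_eq, ← aeval_def]; exact hpα

/-! ### Liouville's inequality -/

/-- A pure `(N + 1)`-th power, so that every factor can be absorbed into one `C ^ (N + 1)`; the
number of terms is absorbed by `N + 1 ≤ 2 ^ (N + 1)`. -/
theorem norm_sub_aeval_le {A b M : ℝ} (hM : 1 ≤ M) (hb : 0 ≤ b) {x y : ℂ} (hx : ‖x‖ ≤ M)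
    (hy : ‖y‖ ≤ b) {N : ℕ} {Q : ℤ[X]} (hQ : Q.natDegree ≤ N)
    (hA : ∀ i, |(Q.coeff i : ℝ)| ≤ A) :
    ‖y - aeval x Q‖ ≤ ((b + A + 1) * (2 * M)) ^ (N + 1) := by
  have hA0 : 0 ≤ A := (abs_nonneg _).trans (hA 0)
  have h1 : ‖aeval x Q‖ ≤ A * (2 * M) ^ (N + 1) := by
    rw [aeval_eq_sum_range' (Nat.lt_succ_of_le hQ)]
    calc _ ≤ ∑ i ∈ Finset.range (N + 1), A * M ^ (N + 1) := by
          refine norm_sum_le_of_le _ fun i hi => ?_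
          rw [zsmul_eq_mul, norm_mul, norm_pow, Complex.norm_intCast]
          gcongr
          · exact hA i
          · exact (pow_le_pow_left₀ (norm_nonneg _) hx i).trans
              (pow_le_pow_right₀ hM (Finset.mem_range.mp hi).le)
      _ = A * ((N + 1 : ℕ) * M ^ (N + 1)) := by simp; ring
      _ ≤ _ := by
          rw [mul_pow]
          gcongr
          exact_mod_cast Nat.lt_two_pow_self.le
  have hP : 1 ≤ (2 * M) ^ (N + 1) := one_le_pow₀ (by linarith)
  calc ‖y - aeval x Q‖ ≤ b * (2 * M) ^ (N + 1) + A * (2 * M) ^ (N + 1) := by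
        refine (norm_sub_le _ _).trans (add_le_add ?_ h1)
        nlinarith
    _ ≤ (b + A + 1) * (2 * M) ^ (N + 1) := by nlinarith
    _ ≤ _ := by
        rw [mul_pow (b + A + 1)]
        gcongr
        exact le_self_pow₀ (by linarith) (by simp)

/-- The exponent `N + 1` leaves a factor `D` for `β` even when `N = 0`. -/
theorem isIntegral_pow_mul_sub_aeval {K : Type*} [Field K] {α β : K} {D : ℤ}
    (hα : IsIntegral ℤ (D • α)) (hβ : IsIntegral ℤ (D • β)) {N : ℕ} {Q : ℤ[X]}
    (hQ : Q.natDegree ≤ N) : IsIntegral ℤ ((D : K) ^ (N + 1) * (β - aeval α Q)) := by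
  have hD : IsIntegral ℤ (D : K) := isIntegral_algebraMap
  rw [zsmul_eq_mul] at hα hβ
  rw [mul_sub]
  refine IsIntegral.sub ?_ ?_
  · rw [pow_succ, mul_assoc]
    exact (hD.pow N).mul hβ
  · rw [aeval_eq_sum_range' (Nat.lt_succ_of_le hQ), Finset.mul_sum]
    refine IsIntegral.sum _ fun i hi => ?_
    have hi' : i ≤ N + 1 := (Finset.mem_range.mp hi).le
    have : (D : K) ^ (N + 1) * Q.coeff i • α ^ i =
        (D : K) ^ (N + 1 - i) * (Q.coeff i : K) * ((D : K) * α) ^ i := by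
      rw [zsmul_eq_mul, mul_pow, ← Nat.sub_add_cancel hi', pow_add, Nat.sub_add_cancel hi']; ring
    rw [this]
    exact ((hD.pow _).mul isIntegral_algebraMap).mul (hα.pow i)

theorem one_le_prod_norm_embeddings {K : Type*} [Field K] [NumberField K] {x : K}
    (hx : IsIntegral ℤ x) (h0 : x ≠ 0) : 1 ≤ ∏ σ : K →ₐ[ℚ] ℂ, ‖σ x‖ := by
  obtain ⟨m, hm⟩ := IsIntegrallyClosed.isIntegral_iff.mp (Algebra.isIntegral_norm ℚ hx)
  have h := Algebra.norm_eq_prod_embeddings ℚ ℂ x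
  rw [← norm_prod, ← h, ← hm]
  have : m ≠ 0 := by
    rintro rfl
    rw [map_zero] at hm
    exact h0 (Algebra.norm_eq_zero_iff.mp hm.symm)
  have h1 : 1 ≤ |m| := Int.one_le_abs this
  simpa [Complex.norm_intCast] using (by exact_mod_cast h1 : (1 : ℝ) ≤ |(m : ℝ)|)

/-- Liouville's inequality for values of integer polynomials with bounded coefficients. -/
theorem exists_one_le_pow_mul_norm_sub_aeval {K : Type*} [Field K] [NumberField K] (α β : K)
    (A : ℝ) : ∃ C : ℝ, 1 ≤ C ∧ ∀ (N : ℕ) (Q : ℤ[X]), Q.natDegree ≤ N →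
      (∀ i, |(Q.coeff i : ℝ)| ≤ A) → β - aeval α Q ≠ 0 → ∀ φ : K →ₐ[ℚ] ℂ,
        1 ≤ C ^ (N + 1) * ‖φ (β - aeval α Q)‖ := by
  classical
  have halg (x : K) : IsAlgebraic ℤ x :=
    (IsFractionRing.isAlgebraic_iff ℤ ℚ K).mpr (Algebra.IsAlgebraic.isAlgebraic x)
  obtain ⟨D₁, hD₁, h₁⟩ := (halg α).exists_integral_multiple
  obtain ⟨D₂, hD₂, h₂⟩ := (halg β).exists_integral_multiple
  set D := D₁ * D₂ with hDdef
  have hD : D ≠ 0 := mul_ne_zero hD₁ hD₂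
  have hα : IsIntegral ℤ (D • α) := by
    rw [hDdef, mul_comm, mul_smul]; exact h₁.smul D₂
  have hβ : IsIntegral ℤ (D • β) := by
    rw [hDdef, mul_smul]; exact h₂.smul D₁
  set M := 1 + ∑ σ : K →ₐ[ℚ] ℂ, ‖σ α‖
  set b := ∑ σ : K →ₐ[ℚ] ℂ, ‖σ β‖
  have hM : 1 ≤ M := le_add_of_nonneg_right (by positivity)
  have hb : 0 ≤ b := by positivity
  have hD1 : 1 ≤ ‖(D : ℂ)‖ := by
    rw [Complex.norm_intCast]; exact_mod_cast Int.one_le_abs hD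
  set E := max 1 (‖(D : ℂ)‖ * ((b + A + 1) * (2 * M)))
  have hE : 1 ≤ E := le_max_left _ _
  refine ⟨‖(D : ℂ)‖ * E ^ (Fintype.card (K →ₐ[ℚ] ℂ)),
    one_le_mul_of_one_le_of_one_le hD1 (one_le_pow₀ hE), fun N Q hQ hA h0 φ => ?_⟩
  have hA0 : 0 ≤ A := (abs_nonneg _).trans (hA 0)
  -- The norm of a nonzero algebraic integer is a nonzero integer. Bounding every conjugate except
  -- the one at `φ` by `E ^ (N + 1)` leaves a lower bound at `φ`.
  have key := one_le_prod_norm_embeddings (isIntegral_pow_mul_sub_aeval hα hβ hQ)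
    (mul_ne_zero (pow_ne_zero _ (Int.cast_ne_zero.mpr hD)) h0)
  have hσ (σ : K →ₐ[ℚ] ℂ) :
      ‖σ ((D : K) ^ (N + 1) * (β - aeval α Q))‖ = ‖(D : ℂ)‖ ^ (N + 1) * ‖σ (β - aeval α Q)‖ := by
    rw [map_mul, map_pow, map_intCast, norm_mul, norm_pow]
  have hle (σ : K →ₐ[ℚ] ℂ) : ‖σ ((D : K) ^ (N + 1) * (β - aeval α Q))‖ ≤ E ^ (N + 1) := by
    have h1 : σ (β - aeval α Q) = σ β - aeval (σ α) Q := by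
      rw [map_sub]
      congr 1
      exact (aeval_algHom_apply (σ.restrictScalars ℤ) α Q).symm
    have hx : ‖σ α‖ ≤ M := by
      have := Finset.single_le_sum (f := fun σ : K →ₐ[ℚ] ℂ => ‖σ α‖)
        (fun _ _ => norm_nonneg _) (Finset.mem_univ σ)
      simp only [M]; linarith
    have hy : ‖σ β‖ ≤ b := Finset.single_le_sum (f := fun σ : K →ₐ[ℚ] ℂ => ‖σ β‖)
        (fun _ _ => norm_nonneg _) (Finset.mem_univ σ)
    rw [hσ, h1]
    refine le_trans ?_ (pow_le_pow_left₀ (by positivity) (le_max_right _ _) _)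
    rw [mul_pow]
    gcongr
    exact norm_sub_aeval_le hM hb hx hy hQ hA
  have hprod : ∏ σ ∈ Finset.univ.erase φ, ‖σ ((D : K) ^ (N + 1) * (β - aeval α Q))‖ ≤
      (E ^ Fintype.card (K →ₐ[ℚ] ℂ)) ^ (N + 1) := by
    calc _ ≤ ∏ _σ ∈ Finset.univ.erase φ, E ^ (N + 1) :=
        Finset.prod_le_prod (fun _ _ => norm_nonneg _) fun σ _ => hle σ
      _ ≤ _ := by
        rw [Finset.prod_const, ← pow_mul, ← pow_mul, mul_comm]
        refine pow_le_pow_right₀ hE (Nat.mul_le_mul_right _ ?_)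
        exact Finset.card_le_univ _
  rw [← Finset.mul_prod_erase _ _ (Finset.mem_univ φ), hσ] at key
  calc _ ≤ _ := key
    _ ≤ ‖(D : ℂ)‖ ^ (N + 1) * ‖φ (β - aeval α Q)‖ *
        (E ^ Fintype.card (K →ₐ[ℚ] ℂ)) ^ (N + 1) := by gcongr
    _ = _ := by rw [mul_pow]; ring

/-! ### Blocks, gaps and Mahler's criterion -/

namespace LacunarySeries

variable {f : PowerSeries ℤ} {s t : ℕ → ℕ}

theorem StronglyLacunaryWith.s_lt_s (hf : StronglyLacunaryWith f s t) {n : ℕ} (hn : 1 ≤ n) :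
    s n < s (n + 1) := (hf.s_lt_t n hn).trans_le (hf.t_le_s n)

theorem StronglyLacunaryWith.le_s (hf : StronglyLacunaryWith f s t) (n : ℕ) : n ≤ s (n + 1) := by
  induction n with
  | zero => exact Nat.zero_le _
  | succ n ih => exact ih.trans_lt (hf.s_lt_s (Nat.le_add_left 1 n))

theorem StronglyLacunaryWith.tendsto_s (hf : StronglyLacunaryWith f s t) :
    Filter.Tendsto s Filter.atTop Filter.atTop :=
  (Filter.tendsto_add_atTop_iff_nat 1).mp
    (Filter.tendsto_atTop_mono hf.le_s Filter.tendsto_id)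

theorem coeff_block (f : PowerSeries ℤ) (s t : ℕ → ℕ) (n i : ℕ) : (block f s t n).coeff i =
    if t (n - 1) ≤ i ∧ i ≤ s n then PowerSeries.coeff i f else 0 := by
  simp [block, finsetSum_coeff, coeff_monomial]

theorem StronglyLacunaryWith.trunc_s_eq_trunc_t (hf : StronglyLacunaryWith f s t) {n : ℕ}
    (hn : 1 ≤ n) : PowerSeries.trunc (s n + 1) f = PowerSeries.trunc (t n) f := by
  ext i
  have := hf.s_lt_t n hn
  have := hf.coeff_eq_zero_of_gap n hn i
  simp only [PowerSeries.coeff_trunc]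
  grind

theorem StronglyLacunaryWith.trunc_add_block (hf : StronglyLacunaryWith f s t) {n : ℕ}
    (hn : 1 ≤ n) : PowerSeries.trunc (s n + 1) f + block f s t (n + 1) =
      PowerSeries.trunc (s (n + 1) + 1) f := by
  rw [hf.trunc_s_eq_trunc_t hn]
  ext i
  have := hf.t_le_s n
  simp only [coeff_add, coeff_block, PowerSeries.coeff_trunc, Nat.add_sub_cancel]
  grind

/-- If all late blocks vanished, the truncations would freeze and `f` would be a polynomial. -/
theorem StronglyLacunaryWith.infinite_block_ne_zero (hf : StronglyLacunaryWith f s t) :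
    {n : ℕ | 1 ≤ n ∧ block f s t n ≠ 0}.Infinite := by
  intro hfin
  obtain ⟨m, hm⟩ := hfin.bddAbove
  have hzero : ∀ n, m < n → 1 ≤ n → block f s t n = 0 := fun n hn h1 => by
    by_contra h
    exact absurd (hm ⟨h1, h⟩) (not_le.mpr hn)
  have hconst : ∀ j, PowerSeries.trunc (s (m + 1 + j) + 1) f =
      PowerSeries.trunc (s (m + 1) + 1) f := by
    intro j
    induction j with
    | zero => rfl
    | succ j ih =>
      rw [← ih, ← add_assoc, ← hf.trunc_add_block (by omega), hzero _ (by omega) (by omega),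
        add_zero]
  obtain ⟨k, hk, hlt⟩ := hf.infinite_support.exists_gt (s (m + 1))
  have h := congrArg (fun p => p.coeff k) (hconst k)
  have hle : k ≤ s (m + 1 + k) := (Nat.le_add_left k m).trans
    (by rw [add_right_comm]; exact hf.le_s (m + k))
  simp only [PowerSeries.coeff_trunc] at h
  rw [if_pos (by omega), if_neg (by omega)] at h
  exact hk h

theorem abs_coeff_block_le {A : ℝ} (hA : ∀ k, |((PowerSeries.coeff k f : ℤ) : ℝ)| ≤ A) (n i : ℕ) :
    |((block f s t n).coeff i : ℝ)| ≤ A := by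
  rw [coeff_block]
  split_ifs
  · exact hA i
  · simpa using (abs_nonneg _).trans (hA 0)

theorem abs_coeff_trunc_le {A : ℝ} (hA : ∀ k, |((PowerSeries.coeff k f : ℤ) : ℝ)| ≤ A) (n i : ℕ) :
    |((PowerSeries.trunc n f).coeff i : ℝ)| ≤ A := by
  rw [PowerSeries.coeff_trunc]
  split_ifs
  · exact hA i
  · simpa using (abs_nonneg _).trans (hA 0)

theorem StronglyLacunaryWith.exists_block_of_not_mahlerCondition
    (hf : StronglyLacunaryWith f s t) {α : ℂ} (h : ¬ MahlerCondition f s t α) :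
    ∃ n, block f s t n ≠ 0 ∧ aeval α (block f s t n) = 0 := by
  by_contra! hne
  exact h (hf.infinite_block_ne_zero.mono fun n hn => ⟨hn.1, hne n hn.2⟩)

/-- Transcendental `α`, whose `minpoly` has degree 0, do not enter: failure of Mahler's condition
already makes `α` algebraic. -/
theorem StronglyLacunaryWith.finite_not_mahlerCondition (hf : StronglyLacunaryWith f s t)
    (hb : BoundedType f) (d : ℕ) :
    {α : ℂ | (minpoly ℚ α).natDegree ≤ d ∧ ¬ MahlerCondition f s t α}.Finite := by
  obtain ⟨A, -, hA⟩ := hb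
  refine (finite_roots_of_natDegree_minpoly_le A d).subset fun α hα => ⟨hα.1, ?_⟩
  obtain ⟨n, h0, hn⟩ := hf.exists_block_of_not_mahlerCondition hα.2
  exact ⟨_, h0, abs_coeff_block_le hA n, hn⟩

theorem exists_norm_term_le {α : ℂ} (hα : (‖α‖₊ : ℝ≥0∞) < radius f) :
    ∃ C q : ℝ, 0 < C ∧ 0 ≤ q ∧ q < 1 ∧ ∀ k, ‖term f α k‖ ≤ C * q ^ k := by
  obtain ⟨r, hαr, hr⟩ := ENNReal.lt_iff_exists_nnreal_btwn.mp hα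
  have hαr' : ‖α‖ < r := by exact_mod_cast hαr
  have hr0 : (0 : ℝ) < r := (norm_nonneg _).trans_lt hαr'
  obtain ⟨C, hC, h⟩ := FormalMultilinearSeries.norm_mul_pow_le_of_lt_radius _ hr
  refine ⟨C, ‖α‖ / r, hC, by positivity, (div_lt_one hr0).mpr hαr', fun k => ?_⟩
  have hk := h k
  rw [FormalMultilinearSeries.ofScalars_norm] at hk
  rw [term, norm_mul, norm_pow, div_pow, mul_div_assoc', le_div_iff₀ (by positivity),
    mul_right_comm]
  gcongr

theorem summable_term {α : ℂ} (hα : (‖α‖₊ : ℝ≥0∞) < radius f) : Summable (term f α) := by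
  obtain ⟨C, q, -, hq0, hq1, h⟩ := exists_norm_term_le hα
  exact .of_norm_bounded ((summable_geometric_of_lt_one hq0 hq1).mul_left C) h

theorem aeval_trunc (f : PowerSeries ℤ) (α : ℂ) (n : ℕ) :
    aeval α (PowerSeries.trunc n f) = ∑ k ∈ Finset.range n, term f α k := by
  induction n with
  | zero => simp
  | succ n ih =>
    rw [PowerSeries.trunc_succ, map_add, ih, Finset.sum_range_succ, aeval_monomial]
    rfl

theorem StronglyLacunaryWith.eventually_pow_mul_lt_one (hf : StronglyLacunaryWith f s t)
    {B C q : ℝ} (hC : 1 ≤ C) (hB : 0 ≤ B) (hq0 : 0 ≤ q) (hq1 : q < 1) :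
    ∀ᶠ n in Filter.atTop, C ^ (s n + 1) * (B * q ^ t n) < 1 := by
  -- The square of `C` comes from `s n + 1 ≤ 2 * s n`; once `t n ≥ L * s n`, the product is at most
  -- `B * (1 / 2) ^ s n`.
  obtain ⟨L, hL⟩ := exists_pow_lt_of_lt_one (show 0 < 1 / (2 * C ^ 2) by positivity) hq1
  have hL' : C ^ 2 * q ^ L ≤ 1 / 2 := by
    have : 0 < C ^ 2 := by positivity
    calc C ^ 2 * q ^ L ≤ C ^ 2 * (1 / (2 * C ^ 2)) := by gcongr
      _ = 1 / 2 := by field_simp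
  have hlim : Filter.Tendsto (fun n => B * (1 / 2 : ℝ) ^ s n) Filter.atTop (nhds 0) := by
    simpa using ((tendsto_pow_atTop_nhds_zero_of_lt_one (by norm_num)
      (by norm_num : (1 / 2 : ℝ) < 1)).comp hf.tendsto_s).const_mul B
  filter_upwards [hlim.eventually_lt_const one_pos, hf.tendsto_s.eventually_ge_atTop 1,
    hf.tendsto_ratio.eventually_ge_atTop (L : ℝ)] with n h1 h2 h3
  have hs : (0 : ℝ) < s n := by exact_mod_cast h2
  rw [le_div_iff₀ hs] at h3
  have ht : L * s n ≤ t n := by exact_mod_cast h3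
  refine lt_of_le_of_lt ?_ h1
  calc C ^ (s n + 1) * (B * q ^ t n) ≤ C ^ (2 * s n) * (B * q ^ (L * s n)) := by
        gcongr ?_ * (B * ?_)
        · exact pow_le_pow_right₀ hC (by omega)
        · exact pow_le_pow_of_le_one hq0 hq1.le ht
    _ = B * (C ^ 2 * q ^ L) ^ s n := by rw [mul_pow, ← pow_mul, ← pow_mul]; ring
    _ ≤ _ := by gcongr

theorem exists_one_le_pow_mul_norm_sub_trunc (hb : BoundedType f) {α β : ℂ}
    (hα : IsAlgebraic ℚ α) (hβ : IsAlgebraic ℚ β) :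
    ∃ C : ℝ, 1 ≤ C ∧ ∀ N, aeval α (PowerSeries.trunc (N + 1) f) ≠ β →
      1 ≤ C ^ (N + 1) * ‖β - aeval α (PowerSeries.trunc (N + 1) f)‖ := by
  obtain ⟨A, -, hA⟩ := hb
  let K := IntermediateField.adjoin ℚ ({α, β} : Set ℂ)
  have hfd : FiniteDimensional ℚ K := by
    refine IntermediateField.finiteDimensional_adjoin ?_
    rintro x (rfl | rfl)
    exacts [hα.isIntegral, hβ.isIntegral]
  have : NumberField K := ⟨⟩
  let a : K := ⟨α, IntermediateField.subset_adjoin ℚ _ (by simp)⟩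
  let b : K := ⟨β, IntermediateField.subset_adjoin ℚ _ (by simp)⟩
  obtain ⟨C, hC, h⟩ := exists_one_le_pow_mul_norm_sub_aeval a b A
  refine ⟨C, hC, fun N hne => ?_⟩
  have hval : K.val (b - aeval a (PowerSeries.trunc (N + 1) f)) =
      β - aeval α (PowerSeries.trunc (N + 1) f) := by
    rw [map_sub]
    congr 1
    exact (aeval_algHom_apply (K.val.restrictScalars ℤ) a _).symm
  rw [← hval]
  refine h N _ (Nat.lt_succ_iff.mp (PowerSeries.natDegree_trunc_lt f N))
    (abs_coeff_trunc_le hA _) (fun h0 => hne ?_) K.val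
  rw [h0, map_zero] at hval
  exact (sub_eq_zero.mp hval.symm).symm

/-- Mahler's transcendence criterion for strongly lacunary series of bounded type. -/
theorem StronglyLacunaryWith.transcendental_tsum (hf : StronglyLacunaryWith f s t)
    (hb : BoundedType f) {α : ℂ} (halg : IsAlgebraic ℚ α) (hM : MahlerCondition f s t α)
    (hα : (‖α‖₊ : ℝ≥0∞) < radius f) : Transcendental ℚ (∑' k, term f α k) := by
  intro hβ
  obtain ⟨C, hC, hL⟩ := exists_one_le_pow_mul_norm_sub_trunc hb halg hβ
  obtain ⟨B, q, hB, hq0, hq1, hterm⟩ := exists_norm_term_le hα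
  have hev : ∀ᶠ n in Filter.atTop,
      aeval α (PowerSeries.trunc (s n + 1) f) = ∑' k, term f α k := by
    filter_upwards [hf.eventually_pow_mul_lt_one hC (div_nonneg hB.le (sub_nonneg.mpr hq1.le)) hq0 hq1,
      Filter.eventually_ge_atTop 1] with n hn h1
    by_contra hne
    refine absurd hn (not_lt.mpr ((hL _ hne).trans ?_))
    gcongr
    -- Across the gap the truncation may be cut at `t n` instead, so the geometric tail starts at `q
    -- ^ t n`.
    rw [hf.trunc_s_eq_trunc_t h1, aeval_trunc, norm_sub_rev, div_mul_eq_mul_div]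
    exact norm_sub_le_of_geometric_bound_of_hasSum hq1 hterm (summable_term hα).hasSum _
  obtain ⟨m, hm⟩ := Filter.eventually_atTop.mp hev
  refine hM ((Set.finite_Iic (m + 1)).subset fun n hn => ?_)
  by_contra hlt
  rw [Set.mem_Iic, not_le] at hlt
  obtain ⟨k, rfl⟩ : ∃ k, n = k + 1 := ⟨n - 1, by omega⟩
  refine hn.2 ?_
  have h := congrArg (aeval α) (hf.trunc_add_block (n := k) (by omega))
  rw [map_add, hm k (by omega), hm (k + 1) (by omega)] at h
  exact left_eq_add.mp h.symm

end LacunarySeries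

end

theorem mainTheorem7 (f : PowerSeries ℤ) (s t : ℕ → ℕ)
    (hf : LacunarySeries.StronglyLacunaryWith f s t)
    (hb : LacunarySeries.BoundedType f) (d : ℝ) (hd : 0 < d) :
    {α : ℂ | IsAlgebraic ℚ α ∧ ((minpoly ℚ α).natDegree : ℝ) ≤ d ∧
        ¬ LacunarySeries.MahlerCondition f s t α}.Finite ∧
      (∀ α : ℂ, IsAlgebraic ℚ α → ((minpoly ℚ α).natDegree : ℝ) ≤ d →
        LacunarySeries.MahlerCondition f s t α → (‖α‖₊ : ℝ≥0∞) < LacunarySeries.radius f →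
          Summable (LacunarySeries.term f α) ∧
            Transcendental ℚ (∑' k : ℕ, LacunarySeries.term f α k)) ∧
      {α : ℂ | IsAlgebraic ℚ α ∧ ((minpoly ℚ α).natDegree : ℝ) ≤ d ∧
        (‖α‖₊ : ℝ≥0∞) < LacunarySeries.radius f ∧
          ¬ Transcendental ℚ (∑' k : ℕ, LacunarySeries.term f α k)}.Finite := by
  have hfin : {α : ℂ | IsAlgebraic ℚ α ∧ ((minpoly ℚ α).natDegree : ℝ) ≤ d ∧
      ¬ LacunarySeries.MahlerCondition f s t α}.Finite :=
    (hf.finite_not_mahlerCondition hb ⌊d⌋₊).subset fun α hα =>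
      ⟨Nat.le_floor hα.2.1, hα.2.2⟩
  refine ⟨hfin, fun α halg _ hM hα =>
    ⟨LacunarySeries.summable_term hα, hf.transcendental_tsum hb halg hM hα⟩,
    hfin.subset fun α hα => ⟨hα.1, hα.2.1, fun hM => ?_⟩⟩
  exact hα.2.2.2 (hf.transcendental_tsum hb hα.1 hM hα.2.2.1)
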